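/- Let $k$ be a field and let $QSym$ be the algebra of quasisymmetric functions over $k$ in the variables $x_1,x_2,\dots$, i.e. of the formal power series of bounded degree in which, for all $a_1,\dots,a_r\ge 1$ and all $i_1<\cdots<i_r$, $j_1<\cdots<j_r$, the coefficients of $x_{i_1}^{a_1}\cdots x_{i_r}^{a_r}$ and $x_{j_1}^{a_1}\cdots x_{j_r}^{a_r}$ agree. It is a Hopf algebra with the coproduct $\Delta(M_\alpha)=\sum_{\alpha=\beta\gamma}M_\beta\otimes M_\gamma$ (sum over all ways of writing the composition $\alpha$ as a concatenation), where $M_{(a_1,\dots,a_r)}=\sum_{i_1<\cdots<i_r}x_{i_1}^{a_1}\cdots x_{i_r}^{a_r}$, and with the counit that takes the constant term. Let $S$ be its antipode. For $n\ge 0$ and $I\subseteq\{1,\dots,n-1\}$ let $$F_I=\sum_{\substack{1\le i_1\le i_2\le\cdots\le i_n\\ i_j<i_{j+1}\text{ for each }j\in I}}x_{i_1}x_{i_2}\cdots x_{i_n}.$$ Let $X=(V,E)$ be a digraph: a finite set $V$ with $n=|V|$ elements and a set $E\subseteq\{(u,v)\in V\times V: u\ne v\}$. For a bijection $\sigma:\{1,\dots,n\}\to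 V$ let $X\mathrm{Des}(\sigma)=\{1\le i\le n-1:(\sigma_i,\sigma_{i+1})\in E\}$, and let the Redei–Berge function of $X$ be $$U_X=\sum_{\sigma}F_{X\mathrm{Des}(\sigma)}\in QSym,$$ where $\sigma$ runs over all bijections $\{1,\dots,n\}\to V$. Let $\overline X$ be the complementary digraph on $V$, in which, for $u\neq v$, $(u,v)$ is an edge if and only if $(u,v)\notin E$. **Theorem.** For every digraph $X$ on the vertex set $V$, $$S(U_X)=(-1)^{|V|}\,U_{\overline X}.$$ -/

import Mathlib

open scoped TensorProduct

noncomputable section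

namespace QuasiSymm

/-! ### Quasisymmetric functions

Power series in countably many variables `x₁, x₂, x₃, …` are `MvPowerSeries ℕ k`; the variable
`x_{i+1}` has index `i : ℕ`.  For an increasing sequence `i : Fin r ↪o ℕ` and exponents
`a : Fin r →₀ ℕ`, the monomial `x_{i 0}^{a 0} ⋯ x_{i (r-1)}^{a (r-1)}` has exponent vector
`a.embDomain i.toEmbedding`. -/

/-- A power series is a quasisymmetric function if it has bounded degree and if, for all exponents
`a` and all increasing sequences `i`, `j` of indices, the coefficients of `∏ x_{i t}^{a t}` and of
`∏ x_{j t}^{a t}` agree. -/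
structure IsQuasisymmetric {k : Type*} [CommRing k] (f : MvPowerSeries ℕ k) : Prop where
  bounded : ∃ d : ℕ, ∀ m : ℕ →₀ ℕ, d < m.degree → MvPowerSeries.coeff m f = 0
  shift : ∀ (r : ℕ) (a : Fin r →₀ ℕ) (i j : Fin r ↪o ℕ),
    MvPowerSeries.coeff (a.embDomain i.toEmbedding) f =
      MvPowerSeries.coeff (a.embDomain j.toEmbedding) f

section Algebra

variable {k : Type*} [CommRing k]

theorem IsQuasisymmetric.algebraMap (c : k) :
    IsQuasisymmetric (algebraMap k (MvPowerSeries ℕ k) c) := by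
  classical
  refine ⟨⟨0, fun m hm => ?_⟩, fun r a i j => ?_⟩
  · rw [MvPowerSeries.algebraMap_apply]
    simp only [Algebra.algebraMap_self, RingHom.id_apply]
    rw [MvPowerSeries.coeff_C, if_neg]
    rintro rfl
    simp at hm
  · rw [MvPowerSeries.algebraMap_apply]
    simp only [Algebra.algebraMap_self, RingHom.id_apply, MvPowerSeries.coeff_C,
      Finsupp.embDomain_eq_zero]

theorem IsQuasisymmetric.add {f g : MvPowerSeries ℕ k} (hf : IsQuasisymmetric f)
    (hg : IsQuasisymmetric g) : IsQuasisymmetric (f + g) := by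
  obtain ⟨d, hd⟩ := hf.bounded
  obtain ⟨e, he⟩ := hg.bounded
  refine ⟨⟨max d e, fun m hm => ?_⟩, fun r a i j => ?_⟩
  · rw [map_add, hd m (by omega), he m (by omega), add_zero]
  · rw [map_add, map_add, hf.shift r a i j, hg.shift r a i j]

theorem coeff_mul_embDomain {r : ℕ} (a : Fin r →₀ ℕ) (i : Fin r ↪ ℕ) (f g : MvPowerSeries ℕ k) :
    MvPowerSeries.coeff (a.embDomain i) (f * g) = ∑ p ∈ Finset.HasAntidiagonal.antidiagonal a,
      MvPowerSeries.coeff (p.1.embDomain i) f * MvPowerSeries.coeff (p.2.embDomain i) g := by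
  classical
  rw [MvPowerSeries.coeff_mul, ← Finsupp.image_prodMap_embDomain_antidiagonal, Finset.sum_image]
  · rfl
  · intro x _ y _ h
    simp only [Prod.map, Prod.mk.injEq] at h
    exact Prod.ext (Finsupp.embDomain_injective _ h.1) (Finsupp.embDomain_injective _ h.2)

theorem IsQuasisymmetric.mul {f g : MvPowerSeries ℕ k} (hf : IsQuasisymmetric f)
    (hg : IsQuasisymmetric g) : IsQuasisymmetric (f * g) := by
  classical
  obtain ⟨d, hd⟩ := hf.bounded
  obtain ⟨e, he⟩ := hg.bounded
  refine ⟨⟨d + e, fun m hm => ?_⟩, fun r a i j => ?_⟩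
  · rw [MvPowerSeries.coeff_mul]
    refine Finset.sum_eq_zero fun p hp => ?_
    rw [Finset.HasAntidiagonal.mem_antidiagonal] at hp
    have h : p.1.degree + p.2.degree = m.degree := by rw [← hp, map_add]
    by_cases h1 : d < p.1.degree
    · rw [hd _ h1, zero_mul]
    · rw [he _ (by omega), mul_zero]
  · rw [coeff_mul_embDomain, coeff_mul_embDomain]
    refine Finset.sum_congr rfl fun p _ => ?_
    rw [hf.shift r p.1 i j, hg.shift r p.2 i j]

end Algebra

/-- The algebra `QSym` of quasisymmetric functions over `k`. -/
def QSym (k : Type*) [CommRing k] : Subalgebra k (MvPowerSeries ℕ k) where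
  carrier := {f | IsQuasisymmetric f}
  mul_mem' := IsQuasisymmetric.mul
  add_mem' := IsQuasisymmetric.add
  algebraMap_mem' := IsQuasisymmetric.algebraMap

/-! ### The monomial basis

Compositions are lists of positive integers. -/

/-- A composition, as a vector of exponents indexed by its parts. -/
def expVec (α : List ℕ+) : Fin α.length →₀ ℕ :=
  Finsupp.equivFunOnFinite.symm fun t => (α.get t : ℕ)

/-- The power series `M_α = ∑_{i₁ < ⋯ < i_r} x_{i₁}^{a₁} ⋯ x_{i_r}^{a_r}` of a composition
`α = (a₁, …, a_r)`: the coefficient of a monomial is the number of increasing sequences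
contributing that monomial. -/
def monomialSeries (k : Type*) [CommRing k] (α : List ℕ+) : MvPowerSeries ℕ k := fun m =>
  (Nat.card {i : Fin α.length ↪o ℕ // (expVec α).embDomain i.toEmbedding = m} : k)

/-- The list of nonzero exponents of a monomial, in increasing order of the variables. -/
def shape {ι : Type*} [LinearOrder ι] (p : ι →₀ ℕ) : List ℕ+ :=
  (p.support.sort (· ≤ ·)).map fun j => (p j).toPNat'

section Shape

variable {k : Type*} [CommRing k]

theorem expVec_apply (α : List ℕ+) (t : Fin α.length) : expVec α t = (α.get t : ℕ) := rfl

theorem support_expVec (α : List ℕ+) : (expVec α).support = Finset.univ := by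
  ext t; simp [expVec_apply]

theorem exists_expVec {ι : Type*} [LinearOrder ι] (p : ι →₀ ℕ) (α : List ℕ+)
    (h : shape p = α) : ∃ i : Fin α.length ↪o ι, (expVec α).embDomain i.toEmbedding = p := by
  have hc : p.support.card = α.length := by
    rw [← h]; simp [shape]
  refine ⟨p.support.orderEmbOfFin hc, ?_⟩
  ext x
  by_cases hx : x ∈ p.support
  · have : x ∈ Set.range (p.support.orderEmbOfFin hc) := by simpa using hx
    obtain ⟨t, rfl⟩ := this
    have e := Finsupp.embDomain_apply_self (p.support.orderEmbOfFin hc).toEmbedding (expVec α) t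
    simp only [RelEmbedding.coe_toEmbedding] at e
    rw [e, expVec_apply]
    subst h
    have hpos : 0 < p (p.support.orderEmbOfFin hc t) := by
      have := Finset.orderEmbOfFin_mem p.support hc t
      exact Nat.pos_of_ne_zero (Finsupp.mem_support_iff.mp this)
    have hg : (shape p).get t = (p (p.support.orderEmbOfFin hc t)).toPNat' := by
      rw [Finset.orderEmbOfFin_apply]
      exact List.getElem_map _
    rw [hg]
    exact PNat.toPNat'_coe hpos
  · rw [Finsupp.embDomain_of_notMem_range, Finsupp.notMem_support_iff.mp hx]
    rintro ⟨t, ht⟩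
    exact hx (ht ▸ Finset.orderEmbOfFin_mem p.support hc t)

theorem shape_of_sorted {ι : Type*} [LinearOrder ι] (p : ι →₀ ℕ) (l : List ι)
    (hl : l.Pairwise (· < ·)) (hs : ∀ x, x ∈ l ↔ p x ≠ 0) :
    shape p = l.map fun j => (p j).toPNat' := by
  have : p.support = l.toFinset := by ext x; simp [hs]
  rw [shape, this, (List.toFinset_sort (· ≤ ·) hl.nodup).mpr (hl.imp fun h => h.le)]

theorem shape_embDomain {ι κ : Type*} [LinearOrder ι] [LinearOrder κ] (p : ι →₀ ℕ) (i : ι ↪o κ) :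
    shape (p.embDomain i.toEmbedding) = shape p := by
  have e : ∀ x, p.embDomain i.toEmbedding (i x) = p x := fun x =>
    Finsupp.embDomain_apply_self i.toEmbedding p x
  rw [shape_of_sorted _ ((p.support.sort (· ≤ ·)).map i)]
  · simp only [shape, List.map_map]
    refine List.map_congr_left fun x _ => ?_
    simp only [Function.comp, e]
  · rw [List.pairwise_map]
    exact (Finset.sortedLT_sort p.support).pairwise.imp fun h => i.lt_iff_lt.mpr h
  · intro y
    simp only [List.mem_map, Finset.mem_sort, Finsupp.mem_support_iff]
    constructor
    · rintro ⟨x, hx, rfl⟩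
      rwa [e]
    · intro hy
      by_contra hc
      apply hy
      by_cases hr : y ∈ Set.range i.toEmbedding
      · obtain ⟨x, rfl⟩ := hr
        by_contra h0
        exact hc ⟨x, by rwa [← e], rfl⟩
      · exact Finsupp.embDomain_of_notMem_range _ _ _ hr

theorem shape_expVec (α : List ℕ+) : shape (expVec α) = α := by
  rw [shape_of_sorted _ (List.finRange α.length) (List.pairwise_lt_finRange _)]
  · conv_rhs => rw [← List.map_get_finRange α]
    refine List.map_congr_left fun x _ => ?_
    rw [expVec_apply]
    exact PNat.coe_toPNat' _
  · intro x; simp [expVec_apply]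

theorem coeff_monomialSeries (α : List ℕ+) (m : ℕ →₀ ℕ) :
    MvPowerSeries.coeff m (monomialSeries k α) = if shape m = α then 1 else 0 := by
  change (Nat.card _ : k) = _
  split_ifs with h
  · obtain ⟨i, hi⟩ := exists_expVec m α h
    rw [Nat.card_eq_one_iff_unique.mpr, Nat.cast_one]
    refine ⟨⟨fun x y => Subtype.ext ?_⟩, ⟨⟨i, hi⟩⟩⟩
    obtain ⟨x, hx⟩ := x
    obtain ⟨y, hy⟩ := y
    have hr : Set.range x = Set.range y := by
      have := congrArg (fun q : ℕ →₀ ℕ => (q.support : Set ℕ)) (hx.trans hy.symm)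
      simpa [Finsupp.support_embDomain, support_expVec] using this
    exact OrderEmbedding.range_inj.mp hr
  · rw [Nat.card_eq_zero.mpr, Nat.cast_zero]
    refine Or.inl ⟨fun x => h ?_⟩
    rw [← x.2, shape_embDomain, shape_expVec]

theorem degree_shape (m : ℕ →₀ ℕ) : ((shape m).map PNat.val).sum = m.degree := by
  have : m.degree = ∑ x ∈ m.support, ((m x).toPNat' : ℕ) := by
    rw [Finsupp.degree_apply]
    refine Finset.sum_congr rfl fun x hx => ?_
    have := Nat.pos_of_ne_zero (Finsupp.mem_support_iff.mp hx)
    simp [this]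
  rw [this, ← Finset.sum_map_toList]
  rw [shape, List.map_map]
  refine List.Perm.sum_eq ?_
  exact (Finset.sort_perm_toList _ _).map _

theorem isQuasisymmetric_monomialSeries (α : List ℕ+) : IsQuasisymmetric (monomialSeries k α) := by
  refine ⟨⟨(α.map PNat.val).sum, fun m hm => ?_⟩, fun r a i j => ?_⟩
  · rw [coeff_monomialSeries, if_neg]
    rintro rfl
    rw [degree_shape] at hm
    exact lt_irrefl _ hm
  · rw [coeff_monomialSeries, coeff_monomialSeries, shape_embDomain, shape_embDomain]

end Shape

/-- The monomial quasisymmetric function `M_α`. -/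
def M (k : Type*) [CommRing k] (α : List ℕ+) : QSym k :=
  ⟨monomialSeries k α, isQuasisymmetric_monomialSeries α⟩

/-- The coefficient of a monomial, as a linear functional on `QSym`. -/
def cf (k : Type*) [CommRing k] (m : ℕ →₀ ℕ) : QSym k →ₗ[k] k :=
  MvPowerSeries.coeff m ∘ₗ (QSym k).val.toLinearMap

/-- The exponent vector of `x₁^{p₁} ⋯ x_r^{p_r}`, on the first `r` variables. -/
def std {r : ℕ} (p : Fin r →₀ ℕ) : ℕ →₀ ℕ := p.embDomain Fin.valEmbedding

section Basis

variable {k : Type*} [CommRing k]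

theorem cf_apply (m : ℕ →₀ ℕ) (f : QSym k) : cf k m f = MvPowerSeries.coeff m f.1 := rfl

theorem cf_M (α : List ℕ+) (m : ℕ →₀ ℕ) : cf k m (M k α) = if shape m = α then 1 else 0 :=
  coeff_monomialSeries α m

theorem shape_std {r : ℕ} (p : Fin r →₀ ℕ) : shape (std p) = shape p :=
  shape_embDomain p (Fin.valOrderEmb r)

theorem cf_eq (m : ℕ →₀ ℕ) (f : QSym k) : cf k m f = cf k (std (expVec (shape m))) f := by
  obtain ⟨i, hi⟩ := exists_expVec m _ rfl
  conv_lhs => rw [← hi]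
  exact f.2.shift _ _ i (Fin.valOrderEmb _)

theorem finite_compositions (d : ℕ) : {α : List ℕ+ | (α.map PNat.val).sum ≤ d}.Finite := by
  refine Set.Finite.subset ((List.finite_length_le (Fin (d + 1)) d).image
    (List.map fun x : Fin (d + 1) => Nat.succPNat x)) ?_
  intro α hα
  have hmem : ∀ a ∈ α, (a : ℕ) ≤ d := fun a ha =>
    (List.single_le_sum (by simp) _ (List.mem_map_of_mem ha)).trans hα
  have hlen : α.length ≤ d := by
    refine le_trans ?_ hα
    have := List.length_le_sum_of_one_le (α.map PNat.val) (by
      intro i hi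
      obtain ⟨a, _, rfl⟩ := List.mem_map.mp hi
      exact a.2)
    simpa using this
  refine ⟨α.map fun a => Fin.ofNat (d + 1) a.natPred, by simpa using hlen, ?_⟩
  rw [List.map_map]
  conv_rhs => rw [← List.map_id α]
  refine List.map_congr_left fun a ha => ?_
  have h1 := hmem a ha
  have h2 := a.natPred_add_one
  apply PNat.eq
  simp only [Function.comp, Nat.succPNat_coe, Fin.val_ofNat, id]
  rw [Nat.mod_eq_of_lt (by omega), Nat.succ_eq_add_one, h2]

/-- The coordinates with respect to the monomial quasisymmetric functions. -/
def coords (k : Type*) [CommRing k] : QSym k ≃ₗ[k] (List ℕ+ →₀ k) where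
  toFun f := Finsupp.ofSupportFinite (fun α => cf k (std (expVec α)) f) (by
    obtain ⟨d, hd⟩ := f.2.bounded
    refine (finite_compositions d).subset fun α hα => ?_
    by_contra hc
    refine hα (hd _ ?_)
    rw [← degree_shape, shape_std, shape_expVec]
    simpa using hc)
  map_add' f g := by ext α; exact map_add (cf k (std (expVec α))) f g
  map_smul' c f := by ext α; exact map_smul (cf k (std (expVec α))) c f
  invFun := Finsupp.linearCombination k (M k)
  left_inv f := by
    apply Subtype.ext
    ext m
    rw [← cf_apply, ← cf_apply, Finsupp.linearCombination_apply, Finsupp.sum, map_sum]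
    simp only [map_smul, cf_M, smul_eq_mul, mul_ite, mul_one, mul_zero]
    rw [Finset.sum_ite_eq, cf_eq m f]
    split_ifs with h
    · rfl
    · exact (Finsupp.notMem_support_iff.mp h).symm
  right_inv c := by
    ext α
    change cf k (std (expVec α)) (Finsupp.linearCombination k (M k) c) = _
    rw [Finsupp.linearCombination_apply, Finsupp.sum, map_sum]
    simp only [map_smul, cf_M, smul_eq_mul, mul_ite, mul_one, mul_zero, shape_std, shape_expVec]
    rw [Finset.sum_ite_eq]
    split_ifs with h
    · rfl
    · exact (Finsupp.notMem_support_iff.mp h).symm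

end Basis

/-- The basis of `QSym` formed by the monomial quasisymmetric functions `M_α`. -/
def basisM (k : Type*) [CommRing k] : Module.Basis (List ℕ+) k (QSym k) := .ofRepr (coords k)

section Coalgebra

variable {k : Type*} [CommRing k]

theorem basisM_apply (α : List ℕ+) : basisM k α = M k α := by
  change Finsupp.linearCombination k (M k) (Finsupp.single α 1) = _
  simp

theorem basisM_repr (α : List ℕ+) (f : QSym k) :
    (basisM k).repr f α = cf k (std (expVec α)) f := rfl

theorem M_nil : M k [] = 1 := by
  apply Subtype.ext
  ext m
  rw [← cf_apply, cf_M]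
  classical
  change _ = MvPowerSeries.coeff m 1
  rw [MvPowerSeries.coeff_one]
  have : shape m = [] ↔ m = 0 := by
    rw [← List.length_eq_zero_iff]
    simp [shape]
  simp only [this]

end Coalgebra

/-- The coproduct `Δ(M_α) = ∑ M_β ⊗ M_γ` over all ways to write `α` as a concatenation `βγ`. -/
def comulM (k : Type*) [CommRing k] : QSym k →ₗ[k] QSym k ⊗[k] QSym k :=
  (basisM k).constr k fun α =>
    ∑ t ∈ Finset.range (α.length + 1), M k (α.take t) ⊗ₜ[k] M k (α.drop t)

/-- The counit `ε(f) = f(0, 0, …)`, the constant term. -/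
def counitM (k : Type*) [CommRing k] : QSym k →ₗ[k] k := cf k 0

section Coalgebra

variable {k : Type*} [CommRing k]

theorem comulM_M (α : List ℕ+) : comulM k (M k α) =
    ∑ t ∈ Finset.range (α.length + 1), M k (α.take t) ⊗ₜ[k] M k (α.drop t) := by
  rw [← basisM_apply, comulM, Module.Basis.constr_basis]

theorem shape_zero : shape (0 : ℕ →₀ ℕ) = [] := by simp [shape]

theorem counitM_M (α : List ℕ+) : counitM k (M k α) = if α = [] then 1 else 0 := by
  rw [counitM, cf_M, shape_zero]
  simp only [eq_comm]

theorem ext_M {N : Type*} [AddCommMonoid N] [Module k N] {f g : QSym k →ₗ[k] N}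
    (h : ∀ α, f (M k α) = g (M k α)) : f = g :=
  (basisM k).ext fun α => by rw [basisM_apply]; exact h α

end Coalgebra

instance (k : Type*) [CommRing k] : Coalgebra k (QSym k) where
  comul := comulM k
  counit := counitM k
  coassoc := by
    refine ext_M fun α => ?_
    simp only [LinearMap.comp_apply, comulM_M, map_sum, LinearMap.rTensor_tmul,
      LinearMap.lTensor_tmul, TensorProduct.sum_tmul, TensorProduct.tmul_sum,
      LinearEquiv.coe_coe, TensorProduct.assoc_tmul]
    rw [Finset.sum_sigma', Finset.sum_sigma']
    refine Finset.sum_bij' (fun x _ => ⟨x.2, x.1 - x.2⟩) (fun x _ => ⟨x.1 + x.2, x.1⟩)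
      ?_ ?_ ?_ ?_ ?_
    · rintro ⟨t, s⟩ h
      simp only [Finset.mem_sigma, Finset.mem_range, List.length_take, List.length_drop] at h ⊢
      omega
    · rintro ⟨t, s⟩ h
      simp only [Finset.mem_sigma, Finset.mem_range, List.length_take, List.length_drop] at h ⊢
      omega
    · rintro ⟨t, s⟩ h
      simp only [Finset.mem_sigma, Finset.mem_range, List.length_take] at h
      have : s + (t - s) = t := by omega
      simp only [this]
    · rintro ⟨t, s⟩ h
      simp
    · rintro ⟨t, s⟩ h
      simp only [Finset.mem_sigma, Finset.mem_range, List.length_take] at h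
      have e : s + (t - s) = t := by omega
      have e' : min s t = s := by omega
      simp only [List.take_take, List.drop_drop, e, e', List.drop_take]
  rTensor_counit_comp_comul := by
    refine ext_M fun α => ?_
    simp only [LinearMap.comp_apply, comulM_M, map_sum, LinearMap.rTensor_tmul, counitM_M]
    rw [Finset.sum_eq_single 0]
    · simp
    · intro t ht h0
      rw [Finset.mem_range] at ht
      rw [if_neg, TensorProduct.zero_tmul]
      intro h
      have := congrArg List.length h
      simp at this
      rcases this with h | h
      · exact h0 h
      · simp [h] at ht; exact h0 ht
    · simp
  lTensor_counit_comp_comul := by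
    refine ext_M fun α => ?_
    simp only [LinearMap.comp_apply, comulM_M, map_sum, LinearMap.lTensor_tmul, counitM_M]
    rw [Finset.sum_eq_single α.length]
    · simp
    · intro t ht h0
      rw [Finset.mem_range] at ht
      rw [if_neg, TensorProduct.tmul_zero]
      intro h
      have := congrArg List.length h
      simp at this
      omega
    · simp

section Bialgebra

variable {k : Type*} [CommRing k]

theorem comul_M (α : List ℕ+) : Coalgebra.comul (R := k) (M k α) =
    ∑ t ∈ Finset.range (α.length + 1), M k (α.take t) ⊗ₜ[k] M k (α.drop t) := comulM_M α

theorem counit_M (α : List ℕ+) : Coalgebra.counit (R := k) (M k α) = if α = [] then 1 else 0 :=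
  counitM_M α

/-- The coefficient of `x^m ⊗ x^{m'}` in an element of `QSym ⊗ QSym`. -/
def cf₂ (k : Type*) [CommRing k] (m m' : ℕ →₀ ℕ) : QSym k ⊗[k] QSym k →ₗ[k] k :=
  LinearMap.mul' k k ∘ₗ TensorProduct.map (cf k m) (cf k m')

theorem cf₂_tmul (m m' : ℕ →₀ ℕ) (f g : QSym k) :
    cf₂ k m m' (f ⊗ₜ g) = cf k m f * cf k m' g := by simp [cf₂]

theorem ext_cf₂ {x y : QSym k ⊗[k] QSym k}
    (h : ∀ α β : List ℕ+,
      cf₂ k (std (expVec α)) (std (expVec β)) x = cf₂ k (std (expVec α)) (std (expVec β)) y) :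
    x = y := by
  have key : ∀ z : QSym k ⊗[k] QSym k, ∀ α β,
      ((basisM k).tensorProduct (basisM k)).repr z (α, β) =
        cf₂ k (std (expVec α)) (std (expVec β)) z := by
    intro z α β
    induction z with
    | zero => simp
    | add z w hz hw => simp only [map_add, Finsupp.add_apply, hz, hw]
    | tmul f g =>
      rw [Module.Basis.tensorProduct_repr_tmul_apply, cf₂_tmul, basisM_repr, basisM_repr]
      simp [mul_comm]
  apply ((basisM k).tensorProduct (basisM k)).repr.injective
  ext ⟨α, β⟩
  rw [key, key, h]

/-- Concatenation of exponent vectors. -/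
def cat {r s : ℕ} (p : Fin r →₀ ℕ) (q : Fin s →₀ ℕ) : Fin (r + s) →₀ ℕ :=
  (p.sumElim q).embDomain finSumFinEquiv.toEmbedding

theorem cat_castAdd {r s : ℕ} (p : Fin r →₀ ℕ) (q : Fin s →₀ ℕ) (i : Fin r) :
    cat p q (Fin.castAdd s i) = p i :=
  Finsupp.embDomain_apply_self finSumFinEquiv.toEmbedding (p.sumElim q) (Sum.inl i)

theorem cat_natAdd {r s : ℕ} (p : Fin r →₀ ℕ) (q : Fin s →₀ ℕ) (i : Fin s) :
    cat p q (Fin.natAdd r i) = q i :=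
  Finsupp.embDomain_apply_self finSumFinEquiv.toEmbedding (p.sumElim q) (Sum.inr i)

theorem shape_cat {r s : ℕ} (p : Fin r →₀ ℕ) (q : Fin s →₀ ℕ) :
    shape (cat p q) = shape p ++ shape q := by
  rw [shape_of_sorted _ ((p.support.sort (· ≤ ·)).map (Fin.castAdd s) ++
    (q.support.sort (· ≤ ·)).map (Fin.natAdd r))]
  · simp only [List.map_append, List.map_map, shape, Function.comp_def, cat_castAdd, cat_natAdd]
  · rw [List.pairwise_append, List.pairwise_map, List.pairwise_map]
    refine ⟨(Finset.sortedLT_sort p.support).pairwise.imp fun h => h,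
      (Finset.sortedLT_sort q.support).pairwise.imp fun h => by simpa using h, ?_⟩
    intro a ha b hb
    obtain ⟨x, _, rfl⟩ := List.mem_map.mp ha
    obtain ⟨y, _, rfl⟩ := List.mem_map.mp hb
    rw [Fin.lt_def]
    simp only [Fin.val_castAdd, Fin.val_natAdd]
    omega
  · intro x
    simp only [List.mem_append, List.mem_map, Finset.mem_sort, Finsupp.mem_support_iff]
    refine Fin.addCases (fun i => ?_) (fun i => ?_) x
    · rw [cat_castAdd]
      constructor
      · rintro (⟨a, ha, h⟩ | ⟨a, ha, h⟩)
        · rwa [← Fin.castAdd_injective _ _ h]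
        · have := congrArg Fin.val h
          simp at this
          omega
      · intro h
        exact Or.inl ⟨i, h, rfl⟩
    · rw [cat_natAdd]
      constructor
      · rintro (⟨a, ha, h⟩ | ⟨a, ha, h⟩)
        · have := congrArg Fin.val h
          simp at this
          omega
        · rwa [← Fin.natAdd_injective _ _ h]
      · intro h
        exact Or.inr ⟨i, h, rfl⟩

theorem cf₂_comul {r s : ℕ} (p : Fin r →₀ ℕ) (q : Fin s →₀ ℕ) (f : QSym k) :
    cf₂ k (std p) (std q) (Coalgebra.comul (R := k) f) = cf k (std (cat p q)) f := by
  suffices h : cf₂ k (std p) (std q) ∘ₗ Coalgebra.comul = cf k (std (cat p q)) from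
    LinearMap.congr_fun h f
  refine ext_M fun α => ?_
  rw [LinearMap.comp_apply, comul_M, map_sum, cf_M, shape_std, shape_cat]
  simp only [cf₂_tmul, cf_M, shape_std]
  split_ifs with h
  · subst h
    rw [Finset.sum_eq_single (shape p).length]
    · simp
    · intro t ht h0
      rw [Finset.mem_range] at ht
      rw [if_neg, zero_mul]
      intro e
      have := congrArg List.length e
      simp at this ht
      omega
    · intro hn
      exact absurd (Finset.mem_range.mpr (by simp)) hn
  · refine Finset.sum_eq_zero fun t _ => ?_
    by_cases h1 : shape p = α.take t
    · rw [if_neg (c := shape q = α.drop t), mul_zero]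
      intro h2
      exact h (by rw [h1, h2, List.take_append_drop])
    · rw [if_neg h1, zero_mul]

theorem cf_mul {r : ℕ} (p : Fin r →₀ ℕ) (f g : QSym k) :
    cf k (std p) (f * g) = ∑ a ∈ Finset.HasAntidiagonal.antidiagonal p,
      cf k (std a.1) f * cf k (std a.2) g :=
  coeff_mul_embDomain p Fin.valEmbedding f.1 g.1

theorem antidiagonal_cat {r s : ℕ} (p : Fin r →₀ ℕ) (q : Fin s →₀ ℕ)
    (F : (Fin (r + s) →₀ ℕ) → (Fin (r + s) →₀ ℕ) → k) :
    ∑ a ∈ Finset.HasAntidiagonal.antidiagonal (cat p q), F a.1 a.2 =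
      ∑ a ∈ Finset.HasAntidiagonal.antidiagonal p, ∑ b ∈ Finset.HasAntidiagonal.antidiagonal q,
        F (cat a.1 b.1) (cat a.2 b.2) := by
  classical
  have inj : ∀ {a c : Fin r →₀ ℕ} {b d : Fin s →₀ ℕ}, cat a b = cat c d → a = c ∧ b = d := by
    intro a c b d h
    constructor
    · ext i; rw [← cat_castAdd a b, h, cat_castAdd]
    · ext i; rw [← cat_natAdd a b, h, cat_natAdd]
  rw [← Finset.sum_product', cat, ← Finsupp.image_prodMap_embDomain_antidiagonal,
    ← Finsupp.image_sumElim_product_antidiagonal, Finset.image_image, Finset.sum_image]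
  · rfl
  · rintro ⟨⟨a, b⟩, ⟨c, d⟩⟩ _ ⟨⟨a', b'⟩, ⟨c', d'⟩⟩ _ h
    have h1 := inj (congrArg Prod.fst h)
    have h2 := inj (congrArg Prod.snd h)
    exact Prod.ext (Prod.ext h1.1 h2.1) (Prod.ext h1.2 h2.2)

theorem cf₂_mul {r s : ℕ} (p : Fin r →₀ ℕ) (q : Fin s →₀ ℕ) (x y : QSym k ⊗[k] QSym k) :
    cf₂ k (std p) (std q) (x * y) =
      ∑ a ∈ Finset.HasAntidiagonal.antidiagonal p, ∑ b ∈ Finset.HasAntidiagonal.antidiagonal q,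
        cf₂ k (std a.1) (std b.1) x * cf₂ k (std a.2) (std b.2) y := by
  induction x with
  | zero => simp
  | add x x' hx hx' => simp only [add_mul, map_add, hx, hx', Finset.sum_add_distrib]
  | tmul f g =>
    induction y with
    | zero => simp
    | add y y' hy hy' => simp only [mul_add, map_add, hy, hy', Finset.sum_add_distrib]
    | tmul f' g' =>
      rw [Algebra.TensorProduct.tmul_mul_tmul, cf₂_tmul, cf_mul, cf_mul, Finset.sum_mul_sum]
      refine Finset.sum_congr rfl fun a _ => Finset.sum_congr rfl fun b _ => ?_
      rw [cf₂_tmul, cf₂_tmul]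
      ring

theorem comul_mul' (f g : QSym k) : Coalgebra.comul (R := k) (f * g) =
    Coalgebra.comul (R := k) f * Coalgebra.comul (R := k) g := by
  refine ext_cf₂ fun α β => ?_
  rw [cf₂_comul, cf_mul,
    antidiagonal_cat _ _ (fun a b => cf k (std a) f * cf k (std b) g), cf₂_mul]
  simp only [cf₂_comul]

theorem counit_mul' (f g : QSym k) : Coalgebra.counit (R := k) (f * g) =
    Coalgebra.counit (R := k) f * Coalgebra.counit (R := k) g := by
  change MvPowerSeries.coeff 0 (f.1 * g.1) = _
  rw [MvPowerSeries.coeff_mul, Finsupp.antidiagonal_zero, Finset.sum_singleton]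
  rfl

end Bialgebra

instance (k : Type*) [CommRing k] : Bialgebra k (QSym k) where
  counit_one := by rw [← M_nil, counit_M, if_pos rfl]
  mul_compr₂_counit := LinearMap.ext₂ counit_mul'
  comul_one := by rw [← M_nil, comul_M]; simp [M_nil, Algebra.TensorProduct.one_def]
  mul_compr₂_comul := LinearMap.ext₂ comul_mul'

/-- The value `S(M_α)` of the antipode, by the recursion `S(1) = 1` and
`∑_{α = βγ} S(M_β) M_γ = 0` for nonempty `α`. -/
def antipodeM (k : Type*) [CommRing k] (α : List ℕ+) : QSym k :=
  if α = [] then 1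
  else -∑ t : Fin α.length, antipodeM k (α.take t) * M k (α.drop t)
termination_by α.length
decreasing_by simp

/-- The values of the right convolution inverse of the identity, which is shown to be the same. -/
def antipodeM' (k : Type*) [CommRing k] (α : List ℕ+) : QSym k :=
  if α = [] then 1
  else -∑ t : Fin α.length, M k (α.take (t + 1)) * antipodeM' k (α.drop (t + 1))
termination_by α.length
decreasing_by
  have := t.2
  simp
  omega

section Hopf

variable {k : Type*} [CommRing k]

theorem conv_left : WithConv.toConv ((basisM k).constr k (antipodeM k)) *
    WithConv.toConv (LinearMap.id : QSym k →ₗ[k] QSym k) = 1 := by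
  apply WithConv.ofConv_injective
  refine ext_M fun α => ?_
  have hb : ∀ β, (basisM k).constr k (antipodeM k) (M k β) = antipodeM k β := fun β => by
    rw [← basisM_apply, Module.Basis.constr_basis]
  change LinearMap.mul' k _ (TensorProduct.map ((basisM k).constr k (antipodeM k)) LinearMap.id
    (Coalgebra.comul (M k α))) = algebraMap k _ (Coalgebra.counit (M k α))
  rw [comul_M, counit_M]
  simp only [map_sum, TensorProduct.map_tmul, LinearMap.mul'_apply, hb, LinearMap.id_apply]
  rw [Finset.sum_range_succ, Finset.sum_range]
  simp only [List.take_length, List.drop_length, M_nil, mul_one]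
  rw [antipodeM.eq_def k α]
  split_ifs with h
  · subst h; simp
  · simp

theorem conv_right : WithConv.toConv (LinearMap.id : QSym k →ₗ[k] QSym k) *
    WithConv.toConv ((basisM k).constr k (antipodeM' k)) = 1 := by
  apply WithConv.ofConv_injective
  refine ext_M fun α => ?_
  have hb : ∀ β, (basisM k).constr k (antipodeM' k) (M k β) = antipodeM' k β := fun β => by
    rw [← basisM_apply, Module.Basis.constr_basis]
  change LinearMap.mul' k _ (TensorProduct.map LinearMap.id ((basisM k).constr k (antipodeM' k))
    (Coalgebra.comul (M k α))) = algebraMap k _ (Coalgebra.counit (M k α))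
  rw [comul_M, counit_M]
  simp only [map_sum, TensorProduct.map_tmul, LinearMap.mul'_apply, hb, LinearMap.id_apply]
  rw [Finset.sum_range_succ', Finset.sum_range]
  simp only [List.take_zero, List.drop_zero, M_nil, one_mul]
  rw [antipodeM'.eq_def k α]
  split_ifs with h
  · subst h; simp
  · simp

end Hopf

/-- `QSym` as a Hopf algebra. The antipode is the two-sided convolution inverse of the identity. -/
instance (k : Type*) [CommRing k] : HopfAlgebra k (QSym k) where
  antipode := (basisM k).constr k (antipodeM k)
  mul_antipode_rTensor_comul := congrArg WithConv.ofConv (conv_left (k := k))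
  mul_antipode_lTensor_comul := by
    have h := left_inv_eq_right_inv (conv_left (k := k)) conv_right
    have h2 := conv_right (k := k)
    rw [← h] at h2
    exact congrArg WithConv.ofConv h2

/-! ### Fundamental quasisymmetric functions -/

/-- The sequences `i₁ ≤ i₂ ≤ ⋯ ≤ i_n` with `i_j < i_{j+1}` for each `j ∈ I`. Here `I ⊆ {1, …, n-1}`
is indexed from `1`, so the strict inequality at `j + 1 ∈ I` is between the entries at the
positions `j` and `j + 1` of `Fin n`. -/
def IsAdmissible {β : Type*} [LinearOrder β] {n : ℕ} (I : Set ℕ) (i : Fin n → β) : Prop :=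
  Monotone i ∧ ∀ (j : ℕ) (h : j + 1 < n), j + 1 ∈ I → i ⟨j, by omega⟩ < i ⟨j + 1, h⟩

/-- The power series `F_I = ∑ x_{i₁} x_{i₂} ⋯ x_{i_n}` over the admissible sequences: the
coefficient of a monomial is the number of admissible sequences contributing that monomial. -/
def fundamentalSeries (k : Type*) [CommRing k] (n : ℕ) (I : Set ℕ) : MvPowerSeries ℕ k := fun m =>
  (Nat.card {i : Fin n → ℕ // IsAdmissible I i ∧ ∑ t, Finsupp.single (i t) 1 = m} : k)

section Fundamental

variable {k : Type*} [CommRing k]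

theorem isAdmissible_comp {β γ : Type*} [LinearOrder β] [LinearOrder γ] {n : ℕ} (I : Set ℕ)
    (i : Fin n → β) (e : β ↪o γ) : IsAdmissible I (e ∘ i) ↔ IsAdmissible I i := by
  simp only [IsAdmissible, Monotone, Function.comp, e.le_iff_le, e.lt_iff_lt]

theorem coeff_fundamentalSeries {n r : ℕ} (I : Set ℕ) (a : Fin r →₀ ℕ) (i : Fin r ↪o ℕ) :
    MvPowerSeries.coeff (a.embDomain i.toEmbedding) (fundamentalSeries k n I) =
      (Nat.card {u : Fin n → Fin r // IsAdmissible I u ∧ ∑ t, Finsupp.single (u t) 1 = a} : k) := by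
  change (Nat.card _ : k) = _
  congr 1
  have hs : ∀ u : Fin n → Fin r, ∑ t, Finsupp.single ((i ∘ u) t) 1 =
      (∑ t, Finsupp.single (u t) 1 : Fin r →₀ ℕ).embDomain i.toEmbedding := by
    intro u
    rw [Finsupp.embDomain_eq_mapDomain, Finsupp.mapDomain_finsetSum]
    simp [Finsupp.mapDomain_single]
  symm
  refine Nat.card_congr (Equiv.ofBijective
    (fun u => ⟨i ∘ u.1, (isAdmissible_comp I u.1 i).mpr u.2.1, by rw [hs, u.2.2]⟩) ⟨?_, ?_⟩)
  · intro u v h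
    have := congrArg Subtype.val h
    exact Subtype.ext (i.injective.comp_left this)
  · rintro ⟨s, hs1, hs2⟩
    have hr : ∀ t, ∃ x, i x = s t := by
      intro t
      by_contra hc
      have h0 := Finsupp.embDomain_of_notMem_range i.toEmbedding a (s t)
        (fun ⟨x, hx⟩ => hc ⟨x, hx⟩)
      rw [← hs2, Finsupp.finsetSum_apply] at h0
      have := (Finset.sum_eq_zero_iff.mp h0) t (Finset.mem_univ t)
      simp at this
    choose u hu using hr
    have hsu : i ∘ u = s := funext hu
    subst hsu
    refine ⟨⟨u, (isAdmissible_comp I u i).mp hs1, ?_⟩, rfl⟩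
    rw [hs] at hs2
    exact Finsupp.embDomain_injective _ hs2

theorem isQuasisymmetric_fundamentalSeries (n : ℕ) (I : Set ℕ) :
    IsQuasisymmetric (fundamentalSeries k n I) := by
  refine ⟨⟨n, fun m hm => ?_⟩, fun r a i j => ?_⟩
  · change (Nat.card _ : k) = 0
    rw [Nat.card_eq_zero.mpr, Nat.cast_zero]
    refine Or.inl ⟨fun x => ?_⟩
    have := x.2.2
    rw [← this, map_sum] at hm
    simp at hm
  · rw [coeff_fundamentalSeries, coeff_fundamentalSeries]

end Fundamental

/-- The fundamental quasisymmetric function `F_I` of degree `n`, for `I ⊆ {1, …, n-1}`. -/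
def F (k : Type*) [CommRing k] (n : ℕ) (I : Set ℕ) : QSym k :=
  ⟨fundamentalSeries k n I, isQuasisymmetric_fundamentalSeries n I⟩

end QuasiSymm

namespace RedeiBerge

/-- A digraph without loops: a set of edges `(u, v)` with `u ≠ v`. -/
structure LooplessDigraph (V : Type*) extends Digraph V where
  loopless : ∀ v, ¬ Adj v v

/-- The complementary digraph: for `u ≠ v`, the pair `(u, v)` is an edge if and only if it is not
an edge of `X`. -/
def LooplessDigraph.complement {V : Type*} (X : LooplessDigraph V) : LooplessDigraph V where
  Adj u v := u ≠ v ∧ ¬ X.Adj u v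
  loopless _ h := h.1 rfl

/-- The `X`-descent set `{1 ≤ i ≤ n - 1 | (σ_i, σ_{i+1}) ∈ E}` of a listing `σ`. -/
def XDes {V : Type*} {n : ℕ} (X : LooplessDigraph V) (σ : Fin n ≃ V) : Set ℕ :=
  {d | ∃ (j : ℕ) (h : j + 1 < n), d = j + 1 ∧ X.Adj (σ ⟨j, by omega⟩) (σ ⟨j + 1, h⟩)}

open Classical in
/-- The Redei–Berge symmetric function `U_X = ∑_σ F_{XDes(σ)}`, the sum over all `V`-listings. -/
def U (k : Type*) [CommRing k] {V : Type*} [Fintype V] (X : LooplessDigraph V) :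
    QuasiSymm.QSym k :=
  ∑ σ : Fin (Fintype.card V) ≃ V, QuasiSymm.F k (Fintype.card V) (XDes X σ)

end RedeiBerge

end

/-!
The proof avoids the antipode of the fundamental quasisymmetric functions and works with blocks of
vertices instead.

A sequence `i` contributing to `F_{XDes(σ)}` is constant on consecutive blocks of the listing `σ`,
and a step inside a block must not be an edge of `X`. Hence the coefficient of
`x₁^{a₁} ⋯ x_r^{a_r}` in `U_X` counts the ways to split `V` into an ordered sequence of blocks of
sizes `a₁, …, a_r` and to choose, on each block, a Hamiltonian path of non-edges (`U_eq_blockSum`).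
More generally, a set function `h` with `h ∅ = 1` and a finite set `B` give a quasisymmetric
function `blockSum h B`, in which a splitting of `B` into blocks has weight `∏ h(block)`.

The splittings are encoded by polynomials in variables `y_v`, `v ∈ V`, of which only the squarefree
coefficients matter: there, multiplication is the subset convolution (`coeff_sqfree_mul`). This makes
`B ↦ blockSum h B` compatible with both operations of `QSym`:
* `Δ(blockSum h B) = ∑_{A ⊆ B} blockSum h A ⊗ blockSum h (B \ A)` (`comul_blockSum`);
* if `∑_{A ⊆ B} (-1)^{|A|} g(A) h(B \ A) = 0` for all nonempty `B`, then
  `∑_{A ⊆ B} (-1)^{|A|} blockSum g A * blockSum h (B \ A) = 0` for all nonempty `B`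
  (`sum_blockSum_mul_blockSum`).

The recursion defining the antipode now gives `S(blockSum h B) = (-1)^{|B|} blockSum g B` by induction
on `B` (`antipode_blockSum`). The theorem is the case in which `g` and `h` count Hamiltonian paths of
edges and of non-edges of `X`. The hypothesis on `g` and `h` holds because, among the ways to cut a
listing of `B` into a path of edges followed by a path of non-edges, the vertex at which the steps
change from edges to non-edges may go to either side of the cut, with opposite signs
(`sum_pathCount_mul_pathCount`).
-/

namespace RedeiBerge

/-! ### Set functions and their subset convolution -/

section SetFunction

variable {k : Type*} [CommRing k] {V : Type*}

/-- The exponent vector of the squarefree monomial `∏_{v ∈ B} y_v`. -/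
noncomputable def sqfree (B : Finset V) : V →₀ ℕ := Finsupp.indicator B fun _ _ => 1

theorem sqfree_apply [DecidableEq V] (B : Finset V) (v : V) :
    sqfree B v = if v ∈ B then 1 else 0 := by
  simp [sqfree, Finsupp.indicator_apply]

theorem support_sqfree (B : Finset V) : (sqfree B).support = B := by
  classical
  ext v; simp [sqfree_apply]

theorem sqfree_injective : Function.Injective (sqfree (V := V)) := fun A B h => by
  rw [← support_sqfree A, h, support_sqfree]

theorem degree_sqfree (B : Finset V) : (sqfree B).degree = B.card := by
  classical
  rw [Finsupp.degree_apply, support_sqfree, Finset.card_eq_sum_ones]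
  exact Finset.sum_congr rfl fun v hv => by rw [sqfree_apply, if_pos hv]

theorem sqfree_empty : sqfree (∅ : Finset V) = 0 := by
  rw [← Finsupp.support_eq_empty, support_sqfree]

/-- On squarefree monomials, multiplication of polynomials is the subset convolution. -/
theorem coeff_sqfree_mul [DecidableEq V] (B : Finset V) (f g : MvPolynomial V k) :
    (f * g).coeff (sqfree B) =
      ∑ A ∈ B.powerset, f.coeff (sqfree A) * g.coeff (sqfree (B \ A)) := by
  have key : ∀ x ∈ Finset.HasAntidiagonal.antidiagonal (sqfree B),
      x.1.support ⊆ B ∧ sqfree x.1.support = x.1 ∧ sqfree (B \ x.1.support) = x.2 := by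
    intro x hx
    rw [Finset.HasAntidiagonal.mem_antidiagonal] at hx
    have hv : ∀ v, x.1 v + x.2 v = if v ∈ B then 1 else 0 := fun v => by
      rw [← sqfree_apply, ← hx]; rfl
    refine ⟨fun v h => ?_, Finsupp.ext fun v => ?_, Finsupp.ext fun v => ?_⟩
    · have h1 := hv v
      rw [Finsupp.mem_support_iff] at h
      by_contra hB
      rw [if_neg hB] at h1
      omega
    · have h1 := hv v
      simp only [sqfree_apply, Finsupp.mem_support_iff]
      split_ifs at h1 ⊢ <;> omega
    · have h1 := hv v
      simp only [sqfree_apply, Finset.mem_sdiff, Finsupp.mem_support_iff]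
      split_ifs at h1 ⊢ <;> grind
  rw [MvPolynomial.coeff_mul]
  refine Finset.sum_bij' (fun x _ => x.1.support) (fun A _ => (sqfree A, sqfree (B \ A)))
    ?_ ?_ ?_ ?_ ?_
  · exact fun x hx => Finset.mem_powerset.mpr (key x hx).1
  · intro A hA
    rw [Finset.mem_powerset] at hA
    rw [Finset.HasAntidiagonal.mem_antidiagonal]
    ext v
    have := @hA v
    simp only [Finsupp.add_apply, sqfree_apply, Finset.mem_sdiff]
    by_cases h1 : v ∈ A <;> by_cases h2 : v ∈ B <;> simp_all
  · exact fun x hx => Prod.ext (key x hx).2.1 (key x hx).2.2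
  · exact fun A _ => support_sqfree A
  · intro x hx
    rw [(key x hx).2.1, (key x hx).2.2]

variable [Fintype V]

/-- The part of degree `a` of the generating polynomial `∑_A h(A) ∏_{v ∈ A} y_v` of a set
function `h`. -/
noncomputable def graded (h : Finset V → k) (a : ℕ) : MvPolynomial V k :=
  ∑ A ∈ Finset.univ.powersetCard a, MvPolynomial.monomial (sqfree A) (h A)

theorem isHomogeneous_graded (h : Finset V → k) (a : ℕ) : (graded h a).IsHomogeneous a := by
  refine MvPolynomial.IsHomogeneous.sum _ _ _ fun A hA => ?_
  refine MvPolynomial.isHomogeneous_monomial _ ?_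
  rw [degree_sqfree, (Finset.mem_powersetCard.mp hA).2]

theorem coeff_graded (h : Finset V → k) (a : ℕ) (A : Finset V) :
    (graded h a).coeff (sqfree A) = if A.card = a then h A else 0 := by
  classical
  simp only [graded, MvPolynomial.coeff_sum, MvPolynomial.coeff_monomial, sqfree_injective.eq_iff,
    Finset.sum_ite_eq', Finset.mem_powersetCard_univ]

theorem graded_zero {h : Finset V → k} (h0 : h ∅ = 1) : graded h 0 = 1 := by
  simp [graded, sqfree_empty, h0]

end SetFunction

/-! ### The quasisymmetric function of a set function -/

section BlockSum

open QuasiSymm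

variable {k : Type*} [CommRing k] {V : Type*} [Fintype V]

/-- The power series `∑_f (∏_{v ∈ B} x_{f v}) (∏_i h(f⁻¹ i))` over all `f : B → ℕ`, for a set
function `h` with `h ∅ = 1`: the coefficient of `x^m` is the sum of `∏_i h(B_i)` over all ways to
split `B` into disjoint blocks `B_i` of sizes `m_i`. -/
noncomputable def blockSeries (h : Finset V → k) (B : Finset V) : MvPowerSeries ℕ k := fun m =>
  (m.prod fun _ a => graded h a).coeff (sqfree B)

theorem coeff_blockSeries (h : Finset V → k) (B : Finset V) (m : ℕ →₀ ℕ) :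
    MvPowerSeries.coeff m (blockSeries h B) =
      (m.prod fun _ a => graded h a).coeff (sqfree B) := rfl

theorem isHomogeneous_prod_graded {ι : Type*} (h : Finset V → k) (m : ι →₀ ℕ) :
    (m.prod fun _ a => graded h a).IsHomogeneous m.degree :=
  MvPolynomial.IsHomogeneous.prod _ _ _ fun _ _ => isHomogeneous_graded h _

theorem isQuasisymmetric_blockSeries (h : Finset V → k) (B : Finset V) :
    IsQuasisymmetric (blockSeries h B) := by
  refine ⟨⟨B.card, fun m hm => ?_⟩, fun r a i j => ?_⟩
  · rw [coeff_blockSeries]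
    refine (isHomogeneous_prod_graded h m).coeff_eq_zero ?_
    rw [degree_sqfree]
    exact hm.ne
  · rw [coeff_blockSeries, coeff_blockSeries, Finsupp.prod_embDomain, Finsupp.prod_embDomain]

/-- The quasisymmetric function `∑_f (∏_{v ∈ B} x_{f v}) (∏_i h(f⁻¹ i))`. -/
noncomputable def blockSum (h : Finset V → k) (B : Finset V) : QSym k :=
  ⟨blockSeries h B, isQuasisymmetric_blockSeries h B⟩

theorem cf_blockSum {r : ℕ} {h : Finset V → k} (h0 : h ∅ = 1) (B : Finset V) (p : Fin r →₀ ℕ) :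
    cf k (std p) (blockSum h B) = (∏ t, graded h (p t)).coeff (sqfree B) := by
  change MvPowerSeries.coeff (std p) (blockSeries h B) = _
  rw [coeff_blockSeries, std, Finsupp.prod_embDomain,
    Finsupp.prod_fintype _ _ fun _ => graded_zero h0]

theorem ext_cf {f g : QSym k}
    (h : ∀ α : List ℕ+, cf k (std (expVec α)) f = cf k (std (expVec α)) g) : f = g :=
  (basisM k).repr.injective (Finsupp.ext fun α => by rw [basisM_repr, basisM_repr, h])

theorem blockSum_empty {h : Finset V → k} (h0 : h ∅ = 1) : blockSum h ∅ = 1 := by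
  refine ext_cf fun α => ?_
  rw [cf_blockSum h0, ← M_nil, cf_M, shape_std, shape_expVec, sqfree_empty]
  split_ifs with hα
  · subst hα
    simp
  · obtain ⟨a, l, rfl⟩ := List.exists_cons_of_ne_nil hα
    refine (MvPolynomial.IsHomogeneous.prod Finset.univ _ _
      fun t _ => isHomogeneous_graded h (expVec (a :: l) t)).coeff_eq_zero ?_
    have : 0 < ∑ t, expVec (a :: l) t :=
      Finset.sum_pos (fun t _ => PNat.pos _) ⟨(0 : Fin (l.length + 1)), Finset.mem_univ _⟩
    simpa using this.ne

/-- The coproduct of a block sum splits the ground set: the blocks indexed by the first factor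
make up `A`, those indexed by the second factor its complement. -/
theorem comul_blockSum [DecidableEq V] {h : Finset V → k} (h0 : h ∅ = 1) (B : Finset V) :
    Coalgebra.comul (R := k) (blockSum h B) =
      ∑ A ∈ B.powerset, blockSum h A ⊗ₜ[k] blockSum h (B \ A) := by
  refine ext_cf₂ fun α β => ?_
  rw [cf₂_comul, map_sum, cf_blockSum h0, Fin.prod_univ_add, coeff_sqfree_mul]
  refine Finset.sum_congr rfl fun A _ => ?_
  simp only [cf₂_tmul, cf_blockSum h0, cat_castAdd, cat_natAdd]

theorem counit_blockSum [DecidableEq V] (h : Finset V → k) (B : Finset V) :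
    Coalgebra.counit (R := k) (blockSum h B) = if B = ∅ then 1 else 0 := by
  change MvPowerSeries.coeff 0 (blockSeries h B) = _
  rw [coeff_blockSeries, Finsupp.prod_zero_index, MvPolynomial.coeff_one, ← sqfree_empty]
  simp only [sqfree_injective.eq_iff, eq_comm]

/-- The homogeneity of block sums turns a sign depending on the size of the ground set into signs
depending on the sizes of the blocks. -/
theorem cf_neg_one_pow_smul_blockSum {r : ℕ} {h : Finset V → k} (h0 : h ∅ = 1) (B : Finset V)
    (p : Fin r →₀ ℕ) :
    cf k (std p) ((-1 : k) ^ B.card • blockSum h B) =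
      (∏ t, (-1 : k) ^ p t • graded h (p t)).coeff (sqfree B) := by
  have e : (∏ t, (-1 : k) ^ p t • graded h (p t)) =
      (-1 : k) ^ (∑ t, p t) • ∏ t, graded h (p t) := by
    rw [Finset.prod_smul, Finset.prod_pow_eq_pow_sum]
  rw [map_smul, cf_blockSum h0, e, MvPolynomial.coeff_smul]
  by_cases hd : B.card = ∑ t, p t
  · rw [hd]
  · rw [(MvPolynomial.IsHomogeneous.prod Finset.univ _ _
      fun t _ => isHomogeneous_graded h (p t)).coeff_eq_zero (by rwa [degree_sqfree])]
    simp

theorem prod_sum_antidiagonal {R : Type*} [CommSemiring R] {r : ℕ} (p : Fin r →₀ ℕ)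
    (f g : ℕ → R) :
    ∑ a ∈ Finset.HasAntidiagonal.antidiagonal p, (∏ t, f (a.1 t)) * ∏ t, g (a.2 t) =
      ∏ t, ∑ a ∈ Finset.HasAntidiagonal.antidiagonal (p t), f a.1 * g a.2 := by
  rw [Finset.prod_univ_sum]
  refine Finset.sum_bij' (fun a _ t => (a.1 t, a.2 t))
    (fun x _ => (Finsupp.equivFunOnFinite.symm fun t => (x t).1,
      Finsupp.equivFunOnFinite.symm fun t => (x t).2)) ?_ ?_ ?_ ?_ ?_
  · intro a ha
    rw [Finset.HasAntidiagonal.mem_antidiagonal] at ha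
    rw [Fintype.mem_piFinset]
    intro t
    rw [Finset.HasAntidiagonal.mem_antidiagonal, ← ha]
    rfl
  · intro x hx
    rw [Fintype.mem_piFinset] at hx
    rw [Finset.HasAntidiagonal.mem_antidiagonal]
    ext t
    exact Finset.HasAntidiagonal.mem_antidiagonal.mp (hx t)
  · intro a _
    exact Prod.ext (Finsupp.ext fun _ => rfl) (Finsupp.ext fun _ => rfl)
  · intro x _
    rfl
  · intro a _
    rw [Finset.prod_mul_distrib]

/-- A relation of convolution inverses between two set functions passes to their block sums. -/
theorem sum_blockSum_mul_blockSum [DecidableEq V] {g h : Finset V → k} (g0 : g ∅ = 1)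
    (h0 : h ∅ = 1)
    (hgh : ∀ B : Finset V, B ≠ ∅ → ∑ A ∈ B.powerset, (-1) ^ A.card * g A * h (B \ A) = 0)
    {B : Finset V} (hB : B ≠ ∅) :
    ∑ A ∈ B.powerset, ((-1 : k) ^ A.card • blockSum g A) * blockSum h (B \ A) = 0 := by
  refine ext_cf fun α => ?_
  -- The factor at each part of `α` is a polynomial without squarefree monomials.
  have hfac : ∀ n : ℕ, 0 < n → ∀ C : Finset V,
      (∑ a ∈ Finset.HasAntidiagonal.antidiagonal n,
        ((-1 : k) ^ a.1 • graded g a.1) * graded h a.2).coeff (sqfree C) = 0 := by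
    intro n hn C
    by_cases hCn : C.card = n
    · have hC : C ≠ ∅ := by
        rintro rfl
        rw [Finset.card_empty] at hCn
        exact hn.ne hCn
      rw [← hgh C hC]
      simp only [MvPolynomial.coeff_sum, coeff_sqfree_mul, MvPolynomial.coeff_smul, coeff_graded]
      rw [Finset.sum_comm]
      refine Finset.sum_congr rfl fun A hA => ?_
      have hc := Finset.card_sdiff_add_card_eq_card (Finset.mem_powerset.mp hA)
      rw [Finset.sum_eq_single (A.card, (C \ A).card)]
      · rw [if_pos rfl, if_pos rfl, smul_eq_mul]
      · rintro ⟨a, b⟩ _ hne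
        by_cases h1 : A.card = a
        · have h2 : (C \ A).card ≠ b := by
            rintro rfl
            exact hne (by rw [h1])
          rw [if_neg h2, mul_zero]
        · rw [if_neg h1, smul_zero, zero_mul]
      · intro hnot
        exact absurd (Finset.HasAntidiagonal.mem_antidiagonal.mpr (by simp only; omega)) hnot
    · refine MvPolynomial.IsHomogeneous.coeff_eq_zero (n := n) ?_ (by rwa [degree_sqfree])
      refine MvPolynomial.IsHomogeneous.sum _ _ _ fun a ha => ?_
      rw [← Finset.HasAntidiagonal.mem_antidiagonal.mp ha, smul_mul_assoc,
        MvPolynomial.smul_eq_C_mul]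
      exact ((isHomogeneous_graded g _).mul (isHomogeneous_graded h _)).C_mul _
  have hmul : ∀ A, cf k (std (expVec α)) (((-1 : k) ^ A.card • blockSum g A) *
      blockSum h (B \ A)) = ∑ a ∈ Finset.HasAntidiagonal.antidiagonal (expVec α),
        (∏ t, (-1 : k) ^ a.1 t • graded g (a.1 t)).coeff (sqfree A) *
          (∏ t, graded h (a.2 t)).coeff (sqfree (B \ A)) := fun A => by
    rw [cf_mul]
    simp only [cf_neg_one_pow_smul_blockSum g0, cf_blockSum h0]
  rw [map_sum, map_zero, Finset.sum_congr rfl fun A _ => hmul A, Finset.sum_comm]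
  simp only [← coeff_sqfree_mul]
  rw [← MvPolynomial.coeff_sum, prod_sum_antidiagonal _ (fun a => (-1 : k) ^ a • graded g a)]
  cases α with
  | nil =>
    change (∏ t : Fin 0, _ : MvPolynomial V k).coeff _ = 0
    rw [Fin.prod_univ_zero, MvPolynomial.coeff_one, ← sqfree_empty, if_neg]
    exact fun e => hB (sqfree_injective e).symm
  | cons a l =>
    change (∏ t : Fin (l.length + 1), _ : MvPolynomial V k).coeff _ = 0
    rw [Fin.prod_univ_succ, coeff_sqfree_mul]
    refine Finset.sum_eq_zero fun A _ => ?_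
    rw [hfac (expVec (a :: l) 0) (PNat.pos a), zero_mul]

/-- Convolution-inverse set functions give block sums that the antipode interchanges. -/
theorem antipode_blockSum [DecidableEq V] {g h : Finset V → k} (g0 : g ∅ = 1) (h0 : h ∅ = 1)
    (hgh : ∀ B : Finset V, B ≠ ∅ → ∑ A ∈ B.powerset, (-1) ^ A.card * g A * h (B \ A) = 0)
    (B : Finset V) :
    HopfAlgebra.antipode k (blockSum h B) = (-1 : k) ^ B.card • blockSum g B := by
  induction B using Finset.strongInduction with
  | H B ih =>
    by_cases hB : B = ∅
    · subst hB
      rw [blockSum_empty g0, blockSum_empty h0]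
      simp
    · have h1 := LinearMap.congr_fun (HopfAlgebra.mul_antipode_rTensor_comul (R := k))
        (blockSum h B)
      simp only [LinearMap.comp_apply, comul_blockSum h0, map_sum, LinearMap.rTensor_tmul,
        LinearMap.mul'_apply, counit_blockSum, if_neg hB, map_zero] at h1
      have h2 := sum_blockSum_mul_blockSum g0 h0 hgh hB
      rw [← h2, ← Finset.add_sum_erase _ _ (Finset.mem_powerset_self B),
        ← Finset.add_sum_erase _ (fun A => ((-1 : k) ^ A.card • blockSum g A) * _)
          (Finset.mem_powerset_self B)] at h1
      rw [Finset.sum_congr rfl fun A hA => by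
        rw [ih A (by
          rw [Finset.mem_erase, Finset.mem_powerset] at hA
          exact lt_of_le_of_ne hA.2 hA.1)]] at h1
      have h3 := add_right_cancel h1
      rwa [Finset.sdiff_self, blockSum_empty h0, mul_one, mul_one] at h3

end BlockSum


/-! ### Listings of a finite set -/

section Listing

/-- The words in which each element of `B` occurs once and nothing else occurs. -/
def listings {V : Type*} (B : Finset V) : Finset (List V) :=
  ⟨B.val.lists, Multiset.lists_nodup_finset B⟩

variable {V : Type*} [DecidableEq V]

theorem mem_listings {B : Finset V} {w : List V} :
    w ∈ listings B ↔ w.Nodup ∧ w.toFinset = B := by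
  rw [listings, Finset.mem_mk, Multiset.mem_lists_iff]
  constructor
  · intro h
    have hn : w.Nodup := by
      have := B.nodup
      rw [h] at this
      exact Multiset.coe_nodup.mp this
    refine ⟨hn, Finset.val_injective ?_⟩
    rw [List.toFinset_val, hn.dedup, h]
    rfl
  · rintro ⟨hn, rfl⟩
    rw [List.toFinset_val, hn.dedup]
    rfl

theorem listings_empty {V : Type*} : listings (∅ : Finset V) = {[]} := by
  classical
  ext w
  rw [mem_listings, Finset.mem_singleton]
  constructor
  · rintro ⟨-, h⟩
    simpa using h
  · rintro rfl
    simp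

theorem length_of_mem_listings {B : Finset V} {w : List V} (h : w ∈ listings B) :
    w.length = B.card := by
  rw [mem_listings] at h
  rw [← h.2, List.toFinset_card_of_nodup h.1]

theorem ne_nil_of_mem_listings {B : Finset V} (hB : B ≠ ∅) {w : List V} (h : w ∈ listings B) :
    w ≠ [] := by
  rintro rfl
  exact hB (mem_listings.mp h).2.symm

/-- Cutting a listing of `B` in two amounts to listing a subset and its complement. -/
theorem sum_listings_cut {N : Type*} [AddCommMonoid N] (B : Finset V) (φ : List V → List V → N) :
    ∑ w ∈ listings B, ∑ j ∈ Finset.range (w.length + 1), φ (w.take j) (w.drop j) =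
      ∑ A ∈ B.powerset, ∑ u ∈ listings A, ∑ v ∈ listings (B \ A), φ u v := by
  have e : ∀ A, ∑ u ∈ listings A, ∑ v ∈ listings (B \ A), φ u v =
      ∑ x ∈ listings A ×ˢ listings (B \ A), φ x.1 x.2 := fun A =>
    (Finset.sum_product' _ _ _).symm
  rw [Finset.sum_congr rfl fun A _ => e A, Finset.sum_sigma', Finset.sum_sigma']
  refine Finset.sum_bij' (fun x _ => ⟨(x.1.take x.2).toFinset, x.1.take x.2, x.1.drop x.2⟩)
    (fun y _ => ⟨y.2.1 ++ y.2.2, y.2.1.length⟩) ?_ ?_ ?_ ?_ ?_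
  · rintro ⟨w, j⟩ hx
    simp only [Finset.mem_sigma, Finset.mem_product, Finset.mem_powerset, mem_listings] at hx ⊢
    obtain ⟨⟨hn, rfl⟩, -⟩ := hx
    have hs : w.toFinset = (w.take j).toFinset ∪ (w.drop j).toFinset := by
      rw [← List.toFinset_append, List.take_append_drop]
    have hn' := hn
    rw [← List.take_append_drop j w, List.nodup_append'] at hn'
    refine ⟨hs ▸ Finset.subset_union_left, ⟨hn'.1, trivial⟩, hn'.2.1, ?_⟩
    rw [hs, Finset.union_sdiff_cancel_left]
    exact List.disjoint_toFinset_iff_disjoint.mpr hn'.2.2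
  · rintro ⟨A, u, v⟩ hy
    simp only [Finset.mem_sigma, Finset.mem_product, Finset.mem_powerset, mem_listings] at hy ⊢
    obtain ⟨hA, ⟨hu, rfl⟩, hv, hvB⟩ := hy
    refine ⟨⟨List.nodup_append'.mpr ⟨hu, hv, ?_⟩, ?_⟩, by simp⟩
    · rw [← List.disjoint_toFinset_iff_disjoint, hvB]
      exact Finset.disjoint_sdiff
    · rw [List.toFinset_append, hvB, Finset.union_sdiff_of_subset hA]
  · rintro ⟨w, j⟩ hx
    simp only [Finset.mem_sigma, Finset.mem_range] at hx
    have : min j w.length = j := by omega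
    simp [this]
  · rintro ⟨A, u, v⟩ hy
    simp only [Finset.mem_sigma, Finset.mem_product, mem_listings] at hy
    simp [hy.2.1.2]
  · rintro ⟨w, j⟩ _
    rfl

end Listing

/-! ### Listings along a relation -/

section Chain

open Classical in
/-- The indicator function of the words whose consecutive entries are related by `R`. -/
noncomputable def chainInd (k : Type*) [CommRing k] {V : Type*} (R : V → V → Prop)
    (w : List V) : k :=
  if w.IsChain R then 1 else 0

/-- The number of listings of `A` in which consecutive entries are related by `R`, that is, of
Hamiltonian paths of `R` on `A`. -/
noncomputable def pathCount (k : Type*) [CommRing k] {V : Type*} (R : V → V → Prop)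
    (A : Finset V) : k :=
  ∑ w ∈ listings A, chainInd k R w

variable {k : Type*} [CommRing k] {V : Type*}

theorem chainInd_nil (R : V → V → Prop) : chainInd k R [] = 1 := by simp [chainInd]

theorem pathCount_empty (R : V → V → Prop) : pathCount k R ∅ = 1 := by
  rw [pathCount, listings_empty, Finset.sum_singleton, chainInd_nil]

theorem chainInd_singleton (R : V → V → Prop) (x : V) : chainInd k R [x] = 1 := by
  simp [chainInd]

theorem chainInd_cons_cons_pos {R : V → V → Prop} {x y : V} (h : R x y) (w : List V) :
    chainInd k R (x :: y :: w) = chainInd k R (y :: w) := by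
  have e : (x :: y :: w).IsChain R ↔ (y :: w).IsChain R := by
    rw [List.isChain_cons_cons, and_iff_right h]
  by_cases hw : (y :: w).IsChain R
  · rw [chainInd, chainInd, if_pos hw, if_pos (e.mpr hw)]
  · rw [chainInd, chainInd, if_neg hw, if_neg (mt e.mp hw)]

theorem chainInd_cons_cons_neg {R : V → V → Prop} {x y : V} (h : ¬ R x y) (w : List V) :
    chainInd k R (x :: y :: w) = 0 := by
  simp [chainInd, h]

/-- If a word is cut so that the steps before the cut are in `R` and those after it are not, the
step across the cut is arbitrary. So a word with steps in `R` followed by steps outside `R` has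
exactly two such cuts, at adjacent places, and any other word has none. -/
theorem sum_cut_chain_eq_zero (R : V → V → Prop) (x : V) (w : List V) :
    ∑ j ∈ Finset.range ((x :: w).length + 1), (-1 : k) ^ j *
      (chainInd k R ((x :: w).take j) *
        chainInd k (fun u v => ¬ R u v) ((x :: w).drop j)) = 0 := by
  induction w generalizing x with
  | nil => simp [Finset.sum_range_succ, chainInd_nil, chainInd_singleton]
  | cons y w ih =>
    have h := ih y
    rw [Finset.sum_range_succ'] at h
    rw [Finset.sum_range_succ', List.length_cons, Finset.sum_range_succ']
    simp only [List.take_succ_cons, List.drop_succ_cons, List.take_zero, List.drop_zero,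
      List.length_cons, chainInd_nil, chainInd_singleton] at h ⊢
    by_cases hR : R x y
    · simp only [chainInd_cons_cons_pos hR,
        chainInd_cons_cons_neg (R := fun u v => ¬ R u v) (not_not.mpr hR)]
      have e : ∀ j (c : k), (-1) ^ (j + 1 + 1) * c = -((-1) ^ (j + 1) * c) := fun j c => by ring
      simp only [e, Finset.sum_neg_distrib]
      linear_combination -h
    · simp [chainInd_cons_cons_neg hR, chainInd_cons_cons_pos (R := fun u v => ¬ R u v) hR]

/-- Hamiltonian paths along `R` and along its negation are inverse to each other under signed
subset convolution. -/
theorem sum_pathCount_mul_pathCount [DecidableEq V] (R : V → V → Prop) {B : Finset V}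
    (hB : B ≠ ∅) :
    ∑ A ∈ B.powerset, (-1) ^ A.card * pathCount k R A *
      pathCount k (fun u v => ¬ R u v) (B \ A) = 0 := by
  classical
  have h := sum_listings_cut B fun u v => (-1 : k) ^ u.length *
    (chainInd k R u * chainInd k (fun u v => ¬ R u v) v)
  have hl : ∑ A ∈ B.powerset, (-1) ^ A.card * pathCount k R A *
      pathCount k (fun u v => ¬ R u v) (B \ A) = ∑ A ∈ B.powerset, ∑ u ∈ listings A,
        ∑ v ∈ listings (B \ A), (-1 : k) ^ u.length *
          (chainInd k R u * chainInd k (fun u v => ¬ R u v) v) := by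
    refine Finset.sum_congr rfl fun A _ => ?_
    rw [pathCount, pathCount, mul_assoc, Finset.sum_mul_sum, Finset.mul_sum]
    refine Finset.sum_congr rfl fun u hu => ?_
    rw [Finset.mul_sum, length_of_mem_listings hu]
  rw [hl, ← h]
  refine Finset.sum_eq_zero fun w hw => ?_
  obtain ⟨x, w, rfl⟩ := List.exists_cons_of_ne_nil (ne_nil_of_mem_listings hB hw)
  rw [← sum_cut_chain_eq_zero (k := k) R x w]
  refine Finset.sum_congr rfl fun j hj => ?_
  rw [List.length_take_of_le (Nat.lt_succ_iff.mp (Finset.mem_range.mp hj))]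

/-- On listings of a set, only pairs of distinct vertices matter for a relation. -/
theorem pathCount_congr {R R' : V → V → Prop} (h : ∀ u v, u ≠ v → (R u v ↔ R' u v))
    (A : Finset V) : pathCount k R A = pathCount k R' A := by
  classical
  refine Finset.sum_congr rfl fun w hw => ?_
  have hn := (mem_listings.mp hw).1
  have : w.IsChain R ↔ w.IsChain R' := by
    simp only [List.isChain_iff_getElem]
    refine forall_congr' fun i => forall_congr' fun hi => h _ _ fun e => ?_
    have := (hn.getElem_inj_iff).mp e
    omega
  simp only [chainInd, this]

end Chain


/-! ### Coefficients of fundamental quasisymmetric functions -/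

section Blocks

variable {V : Type*}

/-- The word `w` is a concatenation of words of the prescribed lengths whose consecutive entries
are related by `R`. -/
def ChainBlocks (R : V → V → Prop) : List ℕ → List V → Prop
  | [], w => w = []
  | a :: l, w => a ≤ w.length ∧ (w.take a).IsChain R ∧ ChainBlocks R l (w.drop a)

/-- The word `c ⋯ c (c+1) ⋯ (c+1) ⋯`, with multiplicities given by a list. -/
def blockWord : List ℕ → ℕ → List ℕ
  | [], _ => []
  | a :: l, c => List.replicate a c ++ blockWord l (c + 1)

theorem length_blockWord (l : List ℕ) (c : ℕ) : (blockWord l c).length = l.sum := by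
  induction l generalizing c with
  | nil => rfl
  | cons a l ih => simp [blockWord, ih]

theorem le_of_mem_blockWord {l : List ℕ} {c x : ℕ} (h : x ∈ blockWord l c) : c ≤ x := by
  induction l generalizing c with
  | nil => simp [blockWord] at h
  | cons a l ih =>
    rw [blockWord, List.mem_append] at h
    rcases h with h | h
    · exact (List.eq_of_mem_replicate h).ge
    · exact (Nat.le_succ c).trans (ih h)

theorem pairwise_blockWord (l : List ℕ) (c : ℕ) : (blockWord l c).Pairwise (· ≤ ·) := by
  induction l generalizing c with
  | nil => exact List.Pairwise.nil
  | cons a l ih =>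
    rw [blockWord, List.pairwise_append]
    refine ⟨List.pairwise_replicate.mpr (Or.inr le_rfl), ih _, fun x hx y hy => ?_⟩
    rw [List.eq_of_mem_replicate hx]
    exact (Nat.le_succ c).trans (le_of_mem_blockWord hy)

theorem count_blockWord (l : List ℕ) (c j : ℕ) :
    (blockWord l c).count (c + j) = l.getD j 0 := by
  induction l generalizing c j with
  | nil => simp [blockWord]
  | cons a l ih =>
    rw [blockWord, List.count_append, List.count_replicate]
    cases j with
    | zero =>
      rw [List.count_eq_zero_of_not_mem fun h => ?_]
      · simp
      · have := le_of_mem_blockWord h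
        omega
    | succ j =>
      have e : c + (j + 1) = c + 1 + j := by omega
      rw [e, ih, if_neg (by simp; omega)]
      simp

/-- The condition on two consecutive entries of a word, decorated with the indices of a monomial:
the index increases weakly, and strictly at a step outside `R`. -/
def StepRel (R : V → V → Prop) (x y : V × ℕ) : Prop :=
  x.2 ≤ y.2 ∧ (¬ R x.1 y.1 → x.2 < y.2)

theorem isChain_zip_replicate (R : V → V → Prop) (u : List V) (c : ℕ) :
    (u.zip (List.replicate u.length c)).IsChain (StepRel R) ↔ u.IsChain R := by
  simp [List.isChain_iff_getElem, StepRel]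

theorem chainBlocks_iff (R : V → V → Prop) (l : List ℕ) (c : ℕ) (w : List V) :
    ChainBlocks R l w ↔ w.length = l.sum ∧ (w.zip (blockWord l c)).IsChain (StepRel R) := by
  induction l generalizing c w with
  | nil => simp [ChainBlocks, blockWord]
  | cons a l ih =>
    by_cases ha : a ≤ w.length
    · have hl : (w.take a).length = a := List.length_take_of_le ha
      have hz : w.zip (blockWord (a :: l) c) =
          (w.take a).zip (List.replicate (w.take a).length c) ++
            (w.drop a).zip (blockWord l (c + 1)) := by
        rw [← List.zip_append (by simp), List.take_append_drop, hl, blockWord]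
      rw [ChainBlocks, hz, List.isChain_append, isChain_zip_replicate, ih (c + 1),
        List.length_drop, List.sum_cons]
      have hstep : ∀ x ∈ ((w.take a).zip (List.replicate (w.take a).length c)).getLast?,
          ∀ y ∈ ((w.drop a).zip (blockWord l (c + 1))).head?, StepRel R x y := by
        intro x hx y hy
        have h1 := List.eq_of_mem_replicate (List.of_mem_zip (List.mem_of_getLast? hx)).2
        have h2 := le_of_mem_blockWord (List.of_mem_zip (List.mem_of_head? hy)).2
        have : x.2 < y.2 := by omega
        exact ⟨this.le, fun _ => this⟩
      constructor
      · rintro ⟨-, h1, h2, h3⟩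
        exact ⟨by omega, h1, h3, hstep⟩
      · rintro ⟨h1, h2, h3, -⟩
        exact ⟨ha, h2, by omega, h3⟩
    · rw [ChainBlocks, List.sum_cons]
      constructor
      · exact fun h => absurd h.1 ha
      · exact fun h => by omega

end Blocks

section Coefficients

open QuasiSymm

variable {k : Type*} [CommRing k] {V : Type*}

theorem isAdmissible_XDes_iff {n : ℕ} (X : LooplessDigraph V) (σ : Fin n ≃ V) (i : Fin n → ℕ) :
    IsAdmissible (XDes X σ) i ↔
      ((List.ofFn σ).zip (List.ofFn i)).IsChain (StepRel fun u v => ¬ X.Adj u v) := by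
  simp only [List.isChain_iff_getElem, StepRel, List.getElem_zip, List.getElem_ofFn, not_not,
    List.length_zip, List.length_ofFn, min_self]
  constructor
  · rintro ⟨h1, h2⟩ j hj
    exact ⟨h1 (Fin.mk_le_mk.mpr (Nat.le_succ j)), fun h => h2 j hj ⟨j, hj, rfl, h⟩⟩
  · intro h
    refine ⟨?_, ?_⟩
    · have hc : (List.ofFn i).IsChain (· ≤ ·) := List.isChain_ofFn.mpr fun j hj => (h j hj).1
      have hp := List.pairwise_ofFn.mp hc.pairwise
      intro s t hst
      rcases hst.eq_or_lt with rfl | hlt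
      · exact le_rfl
      · exact hp hlt
    · rintro j hj ⟨j', hj', e, hadj⟩
      obtain rfl : j = j' := by omega
      exact (h j hj).2 hadj

theorem std_expVec_apply (α : List ℕ+) (j : ℕ) :
    std (expVec α) j = (α.map PNat.val).getD j 0 := by
  by_cases hj : j < α.length
  · have := Finsupp.embDomain_apply_self Fin.valEmbedding (expVec α) ⟨j, hj⟩
    rw [std]
    refine this.trans ?_
    rw [expVec_apply, List.getD_eq_getElem _ _ (by simpa using hj), List.getElem_map]
    rfl
  · rw [std, Finsupp.embDomain_of_notMem_range, List.getD_eq_default _ _ (by simpa using hj)]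
    rintro ⟨t, rfl⟩
    exact hj t.2

theorem sum_single_eq_iff {n : ℕ} (i : Fin n → ℕ) (α : List ℕ+) :
    ∑ t, Finsupp.single (i t) 1 = std (expVec α) ↔
      (List.ofFn i).Perm (blockWord (α.map PNat.val) 0) := by
  rw [List.perm_iff_count, DFunLike.ext_iff]
  refine forall_congr' fun j => ?_
  have h := count_blockWord (α.map PNat.val) 0 j
  rw [zero_add] at h
  rw [std_expVec_apply, h, Finsupp.finsetSum_apply]
  have : (List.ofFn i).count j = ∑ t, (Finsupp.single (i t) 1 : ℕ →₀ ℕ) j := by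
    have hl : ∀ l : List ℕ, l.count j = (l.map fun x => (Finsupp.single x 1 : ℕ →₀ ℕ) j).sum := by
      intro l
      induction l with
      | nil => rfl
      | cons x l ih =>
        rw [List.count_cons, List.map_cons, List.sum_cons, ih, Finsupp.single_apply, add_comm]
        simp
    rw [hl, List.map_ofFn, List.sum_ofFn]
    rfl
  rw [this]

open Classical in
/-- The coefficient of `M_α` in `F_{XDes(σ)}`. A monomial determines the weakly increasing sequence
of its indices, so that there is at most one contribution. -/
theorem cf_F_XDes {n : ℕ} (X : LooplessDigraph V) (σ : Fin n ≃ V) (α : List ℕ+) :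
    cf k (std (expVec α)) (F k n (XDes X σ)) =
      if ChainBlocks (fun u v => ¬ X.Adj u v) (α.map PNat.val) (List.ofFn σ) then 1 else 0 := by
  change (Nat.card _ : k) = _
  have huniq : ∀ i : Fin n → ℕ, IsAdmissible (XDes X σ) i →
      ∑ t, Finsupp.single (i t) 1 = std (expVec α) →
        List.ofFn i = blockWord (α.map PNat.val) 0 := fun i h1 h2 =>
    ((sum_single_eq_iff i α).mp h2).eq_of_pairwise (fun _ _ _ _ => le_antisymm)
      (List.pairwise_ofFn.mpr fun _ _ h => h1.1 h.le) (pairwise_blockWord _ _)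
  simp only [chainBlocks_iff _ _ 0, List.length_ofFn]
  split_ifs with h
  · obtain ⟨hn, hc⟩ := h
    rw [Nat.card_eq_one_iff_unique.mpr, Nat.cast_one]
    refine ⟨⟨fun x y => Subtype.ext (List.ofFn_injective ?_)⟩, ?_⟩
    · rw [huniq _ x.2.1 x.2.2, huniq _ y.2.1 y.2.2]
    · have e : List.ofFn (fun t : Fin n => (blockWord (α.map PNat.val) 0)[(t : ℕ)]'(by
          rw [length_blockWord, ← hn]
          exact t.2)) = blockWord (α.map PNat.val) 0 := by
        refine List.ext_getElem ?_ fun _ _ _ => ?_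
        · rw [List.length_ofFn, length_blockWord, hn]
        · rw [List.getElem_ofFn]
      refine ⟨_, (isAdmissible_XDes_iff X σ _).mpr ?_, (sum_single_eq_iff _ α).mpr (.of_eq e)⟩
      rwa [e]
  · rw [Nat.card_eq_zero.mpr, Nat.cast_zero]
    refine Or.inl ⟨fun x => h ?_⟩
    have e := huniq _ x.2.1 x.2.2
    refine ⟨?_, ?_⟩
    · have := congrArg List.length e
      rwa [List.length_ofFn, length_blockWord] at this
    · rw [← e, ← isAdmissible_XDes_iff]
      exact x.2.1

open Classical in
/-- Splitting a listing of `B` into blocks amounts to splitting `B` into blocks and listing each of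
them. -/
theorem sum_chainBlocks [Fintype V] (R : V → V → Prop) (l : List ℕ) (B : Finset V) :
    ∑ w ∈ listings B, (if ChainBlocks R l w then (1 : k) else 0) =
      ((l.map (graded (pathCount k R))).prod).coeff (sqfree B) := by
  induction l generalizing B with
  | nil =>
    rw [List.map_nil, List.prod_nil, MvPolynomial.coeff_one, ← sqfree_empty]
    by_cases hB : B = ∅
    · subst hB
      rw [listings_empty, Finset.sum_singleton, if_pos rfl]
      exact if_pos rfl
    · rw [if_neg fun e => hB (sqfree_injective e).symm]
      exact Finset.sum_eq_zero fun w hw => if_neg (ne_nil_of_mem_listings hB hw)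
  | cons a l ih =>
    rw [List.map_cons, List.prod_cons, coeff_sqfree_mul]
    have h := sum_listings_cut B fun u v =>
      if u.length = a then chainInd k R u * if ChainBlocks R l v then (1 : k) else 0 else 0
    refine Eq.trans (Finset.sum_congr rfl fun w _ => ?_) (h.trans
      (Finset.sum_congr rfl fun A _ => ?_))
    · by_cases ha : a ≤ w.length
      · rw [Finset.sum_eq_single a]
        · rw [if_pos (List.length_take_of_le ha), chainInd]
          simp only [ChainBlocks, ha, true_and]
          split_ifs <;> simp_all
        · intro j hj hne
          rw [List.length_take_of_le (Nat.lt_succ_iff.mp (Finset.mem_range.mp hj)), if_neg hne]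
        · intro hn
          exact absurd (Finset.mem_range.mpr (Nat.lt_succ_iff.mpr ha)) hn
      · rw [if_neg fun h => ha h.1, Finset.sum_eq_zero]
        intro j _
        rw [if_neg]
        rw [List.length_take]
        omega
    · rw [coeff_graded, ← ih, pathCount]
      split_ifs with hA
      · rw [Finset.sum_mul_sum]
        refine Finset.sum_congr rfl fun u hu => Finset.sum_congr rfl fun v _ => ?_
        rw [length_of_mem_listings hu, if_pos hA]
      · rw [zero_mul]
        refine Finset.sum_eq_zero fun u hu => Finset.sum_eq_zero fun v _ => ?_
        rw [length_of_mem_listings hu, if_neg hA]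

theorem sum_equiv_fin [Fintype V] [DecidableEq V] {N : Type*} [AddCommMonoid N]
    (φ : List V → N) :
    ∑ σ : Fin (Fintype.card V) ≃ V, φ (List.ofFn σ) = ∑ w ∈ listings Finset.univ, φ w := by
  refine Finset.sum_bij (fun σ _ => List.ofFn σ) ?_ ?_ ?_ fun _ _ => rfl
  · intro σ _
    rw [mem_listings]
    refine ⟨List.nodup_ofFn.mpr σ.injective, ?_⟩
    ext v
    simpa using σ.surjective v
  · intro σ _ τ _ h
    exact Equiv.coe_fn_injective (List.ofFn_injective h)
  · intro w hw
    have hl := length_of_mem_listings hw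
    rw [Finset.card_univ] at hl
    rw [mem_listings] at hw
    have hm : ∀ v, v ∈ w := fun v => by
      rw [← List.mem_toFinset, hw.2]
      exact Finset.mem_univ v
    refine ⟨(finCongr hl.symm).trans (hw.1.getEquivOfForallMemList w hm), Finset.mem_univ _, ?_⟩
    refine List.ext_getElem (by simp [hl]) fun i h1 h2 => ?_
    simp

/-- In terms of blocks, the coefficients of `U_X` count the ways to split the vertex set into blocks
of prescribed sizes, with a Hamiltonian path of non-edges of `X` on each. -/
theorem U_eq_blockSum [Fintype V] (X : LooplessDigraph V) :
    U k X = blockSum (pathCount k fun u v => ¬ X.Adj u v) Finset.univ := by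
  classical
  refine ext_cf fun α => ?_
  rw [cf_blockSum (pathCount_empty _), U, map_sum]
  simp only [cf_F_XDes]
  rw [sum_equiv_fin fun w =>
    if ChainBlocks (fun u v => ¬ X.Adj u v) (α.map PNat.val) w then (1 : k) else 0,
    sum_chainBlocks, List.map_map, ← Fin.prod_univ_fun_getElem]
  rfl

end Coefficients

end RedeiBerge

theorem mainTheorem2 {k : Type*} [Field k] {V : Type*} [Fintype V]
    (X : RedeiBerge.LooplessDigraph V) :
    HopfAlgebra.antipode k (RedeiBerge.U k X) =
      (-1 : k) ^ Fintype.card V • RedeiBerge.U k X.complement := by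
  classical
  have hc : RedeiBerge.pathCount k (fun u v => ¬ X.complement.Adj u v) =
      RedeiBerge.pathCount k X.Adj := funext fun A =>
    RedeiBerge.pathCount_congr (fun u v huv => by
      simp [RedeiBerge.LooplessDigraph.complement, huv]) A
  rw [RedeiBerge.U_eq_blockSum, RedeiBerge.U_eq_blockSum, hc,
    RedeiBerge.antipode_blockSum (RedeiBerge.pathCount_empty _) (RedeiBerge.pathCount_empty _)
      fun B hB => RedeiBerge.sum_pathCount_mul_pathCount X.Adj hB, Finset.card_univ]
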